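/- **Setting.** Let $Q$ be a finite set (of modes), $T=[0,\infty)$, and let $PC(T,\mathbb{R}^m)$ be the set of maps $T\to\mathbb{R}^m$ which have finitely many discontinuities on every $[0,t]$, with finite one-sided limits at them. Let $(Q\times T)^+$ be the set of non-empty finite sequences $(q_1,t_1)\cdots(q_k,t_k)$ with $q_i\in Q$, $t_i\in T$ (switching sequences), and let $Q^*$ be the set of finite words over $Q$, including the empty word $\epsilon$. An *input-output map* is a map $f:PC(T,\mathbb{R}^m)\times(Q\times T)^+\to\mathbb{R}^p$. Let $\Phi$ be a non-empty set of input-output maps. $\Phi$ admits a *generalized kernel representation* if for all $f\in\Phi$ and all non-empty words $w$ of length $k$ there are functions $K^{f}_w:T^k\to\mathbb{R}^p$ and $G_w:T^k\to\mathbb{R}^{p\times m}$ such that: (1) all $K^f_w$, $G_w$ are analytic on $T^k$; (2) for all words $w,v$ and $q\in Q$, $K^f_{wqqv}(\dots,t,\hat t,\dots)=K^f_{wqv}(\dots,t+\hat t,\dots)$, and the same holds for $G$; (3) $K^f_{vqw}(\dots,0,\dots)=K^f_{vw}(\dots)$, with the time $0$ at the letter $q$, whenever $w\neq\epsilon$,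 and the same for $G$ whenever $v\ne\epsilon$ and $w\neq\epsilon$; (4) $f(u,(q_1,t_1)\cdots(q_k,t_k))=K^f_{q_1\cdots q_k}(t_1,\dots,t_k)+\sum_{i=1}^k\int_0^{t_i}G_{q_i\cdots q_k}(t_i-s,t_{i+1},\dots,t_k)\,u\big(s+\sum_{j<i}t_j\big)\,ds$ for all $u\in PC(T,\mathbb{R}^m)$ and all switching sequences. Write $f_{u,q_1\cdots q_k}(t_1,\dots,t_k)=f(u,(q_1,t_1)\cdots(q_k,t_k))$. The *Markov parameters* of $\Phi$ are the vectors of $\mathbb{R}^p$, for $f\in\Phi$, $q,q_0\in Q$, $1\le j\le m$, $w=q_1\cdots q_k\in Q^*$, $$S_{f,q}(w)=\tfrac{d}{dt_1}\cdots\tfrac{d}{dt_k}f_{0,q_1\cdots q_kq}(t_1,\dots,t_k,0)\big|_{t=0},$$ $$S_{q,q_0,j}(w)=\tfrac{d}{dt_0}\cdots\tfrac{d}{dt_k}f_{e_j,q_0q_1\cdots q_kq}(t_0,\dots,t_k,0)\big|_{t=0}-\tfrac{d}{dt_0}\cdots\tfrac{d}{dt_k}f_{0,q_0q_1\cdots q_kq}(t_0,\dots,t_k,0)\big|_{t=0},$$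 where the derivatives at $0$ are one-sided and $e_j$ is the constant input equal to the $j$-th unit vector; $S_{q,q_0,j}(w)$ is computed from any $f\in\Phi$ (if $\Phi$ admits a generalized kernel representation, it does not depend on which one). For $L,M\in\mathbb{N}$ the matrix $H_{\Phi,L,M}$ has rows indexed by $(v,(q,r))$ with $v\in Q^*$, $|v|\le L$, $q\in Q$, $1\le r\le p$, and columns indexed by $(w,j)$ with $w\in Q^*$, $|w|\le M$, $j\in J_\Phi=\Phi\sqcup(Q\times\{1,\dots,m\})$; its entry is $(S_{f,q}(wv))_r$ if $j=f\in\Phi$ and $(S_{q,q_0,z}(wv))_r$ if $j=(q_0,z)$. Its rank is the dimension of the span of its columns. A *linear switched system* (LSS) $\Sigma$ of dimension $n\ge 0$ consists of matrices $A_q\in\mathbb{R}^{n\times n}$, $B_q\in\mathbb{R}^{n\times m}$, $C_q\in\mathbb{R}^{p\times n}$, $q\in Q$. The state $x_\Sigma(x_0,u,w)$ is obtained from $x_0$ by successively following, for $i=1,\dots,k$ and during time $t_i$, the solution of $\dot x(s)=A_{q_i}x(s)+B_{q_i}u(s+\sum_{j<i}t_j)$; the output is $y_\Sigma(x_0,u,w)=C_{q_k}x_\Sigma(x_0,u,w)$.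 A *realization* $(\Sigma,\mu)$ is an LSS with a map $\mu:\Phi\to\mathbb{R}^n$. It is *semi-reachable* if the states $x_\Sigma(\mu(f),u,w)$ (all $f\in\Phi$, $u$, $w$) span $\mathbb{R}^n$, and *observable* if distinct states induce distinct maps $(u,w)\mapsto y_\Sigma(x,u,w)$. It is an *$N$-partial realization* of $\Phi$ if $S_{q,q_0,j}(q_1\cdots q_k)=C_qA_{q_k}\cdots A_{q_1}B_{q_0}e_j$ and $S_{f,q}(q_1\cdots q_k)=C_qA_{q_k}\cdots A_{q_1}\mu(f)$ for all $q,q_0\in Q$, $f\in\Phi$, $1\le j\le m$ and all words $q_1\cdots q_k$ of length $0\le k\le N$; it is a *minimal* one if no $N$-partial realization has smaller dimension. Realizations $(\Sigma,\mu)$, $(\Sigma',\mu')$ are *isomorphic* if there is a linear isomorphism $S$ of the state-spaces with $A'_qS=SA_q$, $B'_q=SB_q$, $C'_qS=C_q$ for all $q\in Q$, and $S\circ\mu=\mu'$. *Algorithm 1.* Let $n=\operatorname{rank}H_{\Phi,N,N+1}$, let $\mathbf{c}_{w,j}$ be the column of $H_{\Phi,N,N+1}$ with index $(w,j)$, and let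 $\varphi$ be any linear isomorphism from its column space onto $\mathbb{R}^n$. Return the realization $(\Sigma_N,\mu_N)$ of dimension $n$ determined by: the $j$-th column of $B_q$ is $\varphi(\mathbf{c}_{\epsilon,(q,j)})$; $C_q\varphi(\mathbf{c}_{w,j})$ is the vector of the $p$ entries of $\mathbf{c}_{w,j}$ in the rows $(\epsilon,(q,1)),\dots,(\epsilon,(q,p))$, for $|w|\le N+1$, $j\in J_\Phi$; $\varphi^{-1}A_q\varphi(\mathbf{c}_{w,j})=\mathbf{c}_{wq,j}$ for $|w|\le N$, $j\in J_\Phi$; $\mu_N(f)=\varphi(\mathbf{c}_{\epsilon,f})$ for $f\in\Phi$. Abort if the equations for $A_q$ have no solution. **Theorem 2 (Minimal partial realization).** Let $\Phi$ be a non-empty family of input-output maps that admits a generalized kernel representation, and suppose that for some integer $N>0$ $$\operatorname{rank}H_{\Phi,N,N}=\operatorname{rank}H_{\Phi,N+1,N}=\operatorname{rank}H_{\Phi,N,N+1}.$$ Then: 1. A minimal $(2N+1)$-partial realization of $\Phi$ exists; in fact, for every choice of the isomorphism $\varphi$, Algorithm 1 does not abort, its equations determine a unique realization $(\Sigma_N,\mu_N)$,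 and $(\Sigma_N,\mu_N)$ is a minimal $(2N+1)$-partial realization of $\Phi$. 2. Every minimal $(2N+1)$-partial realization of $\Phi$ is semi-reachable and observable, and its dimension is $\operatorname{rank}H_{\Phi,N,N}$. 3. All minimal $(2N+1)$-partial realizations of $\Phi$ are isomorphic. -/

import Mathlib

open scoped NNReal Topology Matrix

noncomputable section

namespace SwitchedSystem

/-- Piecewise-continuity of a map on the time axis `T = [0, ∞)`. At `s = 0` the condition on the
left-hand limit is void, because `𝓝[<] (0 : ℝ≥0) = ⊥`. -/
def IsPiecewiseContinuous {E : Type*} [TopologicalSpace E] (u : ℝ≥0 → E) : Prop :=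
  (∀ t : ℝ≥0, {s | s ≤ t ∧ ¬ ContinuousAt u s}.Finite) ∧
  ∀ s, ¬ ContinuousAt u s →
    (∃ l, Filter.Tendsto u (𝓝[<] s) (𝓝 l)) ∧ (∃ r, Filter.Tendsto u (𝓝[>] s) (𝓝 r))

/-- The space `PC(T, ℝ^m)` of continuous-valued inputs. -/
def PC (m : ℕ) : Type := {u : ℝ≥0 → (Fin m → ℝ) // IsPiecewiseContinuous u}

theorem isPiecewiseContinuous_const {E : Type*} [TopologicalSpace E] (c : E) :
    IsPiecewiseContinuous (fun _ : ℝ≥0 => c) :=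
  ⟨fun t => by simp [continuousAt_const], fun s h => absurd continuousAt_const h⟩

/-- The constant input with value `c`. -/
def PC.const {m : ℕ} (c : Fin m → ℝ) : PC m := ⟨fun _ => c, isPiecewiseContinuous_const c⟩

/-- The non-empty switching sequences `(q₁,t₁)⋯(q_k,t_k)`, i.e. `(Q × T)⁺`. -/
abbrev SwitchSeq (Q : Type*) : Type _ := {w : List (Q × ℝ≥0) // w ≠ []}

/-- Input-output maps `PC(T, ℝ^m) × (Q × T)⁺ → ℝ^p`. -/
abbrev IOMap (Q : Type*) (m p : ℕ) : Type _ := PC m → SwitchSeq Q → (Fin p → ℝ)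

/-- Total duration of a switching sequence. -/
def duration {Q : Type*} (w : List (Q × ℝ≥0)) : ℝ≥0 := (w.map Prod.snd).sum

/-- A linear switched system with modes `Q`, state-space `ℝ^n`, inputs in `ℝ^m` and outputs in
`ℝ^p`. -/
@[ext]
structure LSS (Q : Type*) (n m p : ℕ) where
  A : Q → Matrix (Fin n) (Fin n) ℝ
  B : Q → Matrix (Fin n) (Fin m) ℝ
  C : Q → Matrix (Fin p) (Fin n) ℝ

namespace LSS

variable {Q : Type*} {n m p : ℕ}

/-- `ξ` solves `ξ' = A_q ξ + B_q u(· + τ)` on `[0, ∞)`: it is continuous and satisfies the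
differential equation at every positive time at which the input is continuous. -/
def IsSolution (S : LSS Q n m p) (q : Q) (u : PC m) (τ : ℝ≥0) (ξ : ℝ → (Fin n → ℝ)) : Prop :=
  ContinuousOn ξ (Set.Ici 0) ∧
  ∀ s : ℝ≥0, 0 < s → ContinuousAt u.1 (s + τ) →
    HasDerivAt ξ (S.A q *ᵥ ξ s + S.B q *ᵥ u.1 (s + τ)) (s : ℝ)

/-- `S.StateAt u τ w x₀ x`: starting in `x₀` at the time `τ` and running through the switching
sequence `w` with the input `u`, the system ends in the state `x`. In each mode the solution of the
corresponding differential equation is followed for the prescribed time, starting from the state in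
which the previous mode ended. -/
def StateAt (S : LSS Q n m p) (u : PC m) :
    ℝ≥0 → List (Q × ℝ≥0) → (Fin n → ℝ) → (Fin n → ℝ) → Prop
  | _, [], x₀, x => x = x₀
  | τ, (q, t) :: w, x₀, x =>
      ∃ ξ : ℝ → (Fin n → ℝ), S.IsSolution q u τ ξ ∧ ξ 0 = x₀ ∧ S.StateAt u (τ + t) w (ξ t) x

/-- `x = x_Σ(x₀, u, w)`. -/
def IsState (S : LSS Q n m p) (x₀ : Fin n → ℝ) (u : PC m) (w : SwitchSeq Q)
    (x : Fin n → ℝ) : Prop :=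
  S.StateAt u 0 w.1 x₀ x

/-- `y = y_Σ(x₀, u, w) = C_{q_k} x_Σ(x₀, u, w)`, where `q_k` is the last mode of `w`. -/
def IsOutput (S : LSS Q n m p) (x₀ : Fin n → ℝ) (u : PC m) (w : SwitchSeq Q)
    (y : Fin p → ℝ) : Prop :=
  ∃ x, S.IsState x₀ u w x ∧ y = S.C (w.1.getLast w.2).1 *ᵥ x

/-- The set of states reachable from `X₀`. -/
def reach (S : LSS Q n m p) (X₀ : Set (Fin n → ℝ)) : Set (Fin n → ℝ) :=
  {x | ∃ x₀ ∈ X₀, ∃ u : PC m, ∃ w : SwitchSeq Q, S.IsState x₀ u w x}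

/-- Semi-reachability from `X₀`: the reachable set spans the state-space. -/
def IsSemiReachableFrom (S : LSS Q n m p) (X₀ : Set (Fin n → ℝ)) : Prop :=
  Submodule.span ℝ (S.reach X₀) = ⊤

/-- The states `x₁`, `x₂` induce the same input-output map (as graphs). -/
def Indistinguishable (S : LSS Q n m p) (x₁ x₂ : Fin n → ℝ) : Prop :=
  ∀ (u : PC m) (w : SwitchSeq Q) (y : Fin p → ℝ), S.IsOutput x₁ u w y ↔ S.IsOutput x₂ u w y

def IsObservable (S : LSS Q n m p) : Prop :=
  ∀ x₁ x₂, S.Indistinguishable x₁ x₂ → x₁ = x₂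

/-- `A_w = A_{q_k} ⋯ A_{q_1}` for `w = q_1 ⋯ q_k`. -/
def wordProd (S : LSS Q n m p) (w : List Q) : Matrix (Fin n) (Fin n) ℝ :=
  (w.map S.A).reverse.prod

end LSS

/-- A realization `(Σ, μ)` for the family `Φ`: a linear switched system of dimension `n` with an
assignment of states to the elements of `Φ`. -/
@[ext]
structure Realization {Q : Type*} {m p : ℕ} (Φ : Set (IOMap Q m p)) (n : ℕ) extends
    LSS Q n m p where
  μ : Φ → (Fin n → ℝ)

/-! ### Generalized kernel representations

A function `K_w : T^{|w|} → E` for every word `w` is written as one function of lists of pairs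
`(q₁,t₁)⋯(q_k,t_k)`. -/

section Kernel

variable {Q : Type*} {m p : ℕ}

/-- The function `(t₁,…,t_k) ↦ F((q₁,t₁)⋯(q_k,t_k))` is analytic on `T^k` for each non-empty word
`q₁⋯q_k`. -/
def AnalyticInTimes (F : List (Q × ℝ≥0) → ℝ) : Prop :=
  ∀ w : List Q, w ≠ [] →
    AnalyticOn ℝ
      (fun t : Fin w.length → ℝ => F (List.ofFn fun i => (w.get i, (t i).toNNReal)))
      {t | ∀ i, 0 ≤ t i}

/-- `∑ᵢ ∫₀^{tᵢ} G_{qᵢ⋯q_k}(tᵢ - s, tᵢ₊₁, …, t_k) u(s + t₁ + ⋯ + tᵢ₋₁) ds`. -/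
def forcedResponse (G : List (Q × ℝ≥0) → Matrix (Fin p) (Fin m) ℝ) (u : PC m)
    (w : List (Q × ℝ≥0)) : Fin p → ℝ :=
  ∑ i : Fin w.length, ∫ s in (0 : ℝ)..((w.get i).2 : ℝ),
    G (((w.get i).1, (w.get i).2 - s.toNNReal) :: w.drop (i + 1)) *ᵥ
      u.1 (s.toNNReal + duration (w.take i))

def HasGeneralizedKernelRepresentation (Φ : Set (IOMap Q m p)) : Prop :=
  ∃ (K : Φ → List (Q × ℝ≥0) → (Fin p → ℝ))
    (G : List (Q × ℝ≥0) → Matrix (Fin p) (Fin m) ℝ),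
    ((∀ f i, AnalyticInTimes fun w => K f w i) ∧ (∀ i j, AnalyticInTimes fun w => G w i j)) ∧
    ((∀ f w v q t t', K f (w ++ (q, t) :: (q, t') :: v) = K f (w ++ (q, t + t') :: v)) ∧
      (∀ w v q t t', G (w ++ (q, t) :: (q, t') :: v) = G (w ++ (q, t + t') :: v))) ∧
    ((∀ f v w q, w ≠ [] → K f (v ++ (q, 0) :: w) = K f (v ++ w)) ∧
      (∀ v w q, v ≠ [] → w ≠ [] → G (v ++ (q, 0) :: w) = G (v ++ w))) ∧
    ∀ (f : Φ) (u : PC m) (w : SwitchSeq Q), f.1 u w = K f w.1 + forcedResponse G u w.1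

end Kernel

/-! ### Markov parameters and Hankel matrices -/

section Hankel

variable {Q : Type*} {m p : ℕ}

/-- The mixed derivative `d/dt₁ ⋯ d/dt_k F((q₁,t₁)⋯(q_k,t_k))` at `t₁ = ⋯ = t_k = 0`, with
one-sided derivatives since the times range over `[0, ∞)`. -/
def mixedDeriv {E : Type*} [NormedAddCommGroup E] [NormedSpace ℝ E] :
    List Q → (List (Q × ℝ≥0) → E) → E
  | [], F => F []
  | q :: w, F =>
      derivWithin (fun t : ℝ => mixedDeriv w fun s => F ((q, t.toNNReal) :: s)) (Set.Ici 0) 0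

/-- The mixed derivative in `t₁, …, t_k` at zero of `f_{u, q₁⋯q_k q}(t₁, …, t_k, 0)`, for
`w = q₁⋯q_k`. -/
def ioDeriv (f : IOMap Q m p) (u : PC m) (w : List Q) (q : Q) : Fin p → ℝ :=
  mixedDeriv w fun s => f u ⟨s ++ [(q, 0)], by simp⟩

/-- The Markov parameter `S_{f,q}(w)`. -/
def markovState (f : IOMap Q m p) (q : Q) (w : List Q) : Fin p → ℝ :=
  ioDeriv f (PC.const 0) w q

/-- The Markov parameter `S_{q,q₀,j}(w)`, computed from the element `f` of the family. For a family
that admits a generalized kernel representation the value is the same for all elements `f`. -/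
def markovInput (f : IOMap Q m p) (q q₀ : Q) (j : Fin m) (w : List Q) : Fin p → ℝ :=
  ioDeriv f (PC.const (Pi.single j 1)) (q₀ :: w) q - ioDeriv f (PC.const 0) (q₀ :: w) q

/-- The index set `J_Φ = Φ ∪ (Q × {1,…,m})`. -/
abbrev ColIdx (Φ : Set (IOMap Q m p)) : Type _ := Φ ⊕ (Q × Fin m)

variable (Φ : Set (IOMap Q m p)) (f₀ : Φ)

/-- The Hankel matrix of `Φ`. The set `{1,…,p|Q|}` of row labels is replaced by `Q × {1,…,p}`, the
row `pK + r + 1` being labelled `(σ_{K+1}, r + 1)`. The Markov parameters `S_{q,q₀,j}` are computed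
from the element `f₀` of `Φ`. -/
def hankel : Matrix (List Q × (Q × Fin p)) (List Q × ColIdx Φ) ℝ :=
  fun vi wj =>
    match wj.2 with
    | Sum.inl f => markovState f.1 vi.2.1 (wj.1 ++ vi.1) vi.2.2
    | Sum.inr (q₀, j) => markovInput f₀.1 vi.2.1 q₀ j (wj.1 ++ vi.1) vi.2.2

/-- The words of length at most `L`. -/
abbrev Words (Q : Type*) (L : ℕ) : Type _ := {w : List Q // w.length ≤ L}

/-- The sub-matrix `H_{Φ,L,M}` of the Hankel matrix. -/
def subHankel (L M : ℕ) : Matrix (Words Q L × (Q × Fin p)) (Words Q M × ColIdx Φ) ℝ :=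
  fun vi wj => hankel Φ f₀ (vi.1.1, vi.2) (wj.1.1, wj.2)

/-- The column space of `H_{Φ,L,M}`. -/
def colSpace (L M : ℕ) : Submodule ℝ (Words Q L × (Q × Fin p) → ℝ) :=
  Submodule.span ℝ (Set.range (subHankel Φ f₀ L M).col)

/-- The rank of `H_{Φ,L,M}`, i.e. the dimension of its column space (which is finite when `Q` is,
because then there are finitely many rows). -/
def hankelRank (L M : ℕ) : ℕ := Module.finrank ℝ (colSpace Φ f₀ L M)

/-- The column of `H_{Φ,L,M}` with index `(w,j)`, as an element of the column space. -/
def colVec (L M : ℕ) (w : Words Q M) (j : ColIdx Φ) : colSpace Φ f₀ L M :=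
  ⟨(subHankel Φ f₀ L M).col (w, j), Submodule.subset_span ⟨(w, j), rfl⟩⟩

/-- The empty word. -/
def emptyWord (L : ℕ) : Words Q L := ⟨[], by simp⟩

/-- `w` as a word of length at most `L + 1`. -/
def Words.lift {L : ℕ} (w : Words Q L) : Words Q (L + 1) := ⟨w.1, w.2.trans L.le_succ⟩

/-- The word `wq`. -/
def Words.snoc {L : ℕ} (w : Words Q L) (q : Q) : Words Q (L + 1) :=
  ⟨w.1 ++ [q], by simpa using w.2⟩

end Hankel

/-! ### Partial realizations -/

namespace Realization

variable {Q : Type*} {m p : ℕ} {Φ : Set (IOMap Q m p)} {n : ℕ}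

def IsSemiReachable (R : Realization Φ n) : Prop :=
  R.toLSS.IsSemiReachableFrom (Set.range R.μ)

def IsObservable (R : Realization Φ n) : Prop := R.toLSS.IsObservable

/-- `R` reproduces the Markov parameters of `Φ` indexed by words of length at most `N`. -/
def IsPartialRealization (R : Realization Φ n) (f₀ : Φ) (N : ℕ) : Prop :=
  ∀ w : List Q, w.length ≤ N → ∀ q : Q,
    (∀ (q₀ : Q) (j : Fin m),
      markovInput f₀.1 q q₀ j w = (R.C q * R.wordProd w * R.B q₀) *ᵥ Pi.single j 1) ∧
    ∀ f : Φ, markovState f.1 q w = (R.C q * R.wordProd w) *ᵥ R.μ f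

def IsMinimalPartialRealization (R : Realization Φ n) (f₀ : Φ) (N : ℕ) : Prop :=
  R.IsPartialRealization f₀ N ∧
  ∀ (n' : ℕ) (R' : Realization Φ n'), R'.IsPartialRealization f₀ N → n ≤ n'

/-- The linear map `S` is a morphism of realizations from `R₁` to `R₂`. -/
def IsMorphism {n₁ n₂ : ℕ} (R₁ : Realization Φ n₁) (R₂ : Realization Φ n₂)
    (S : (Fin n₁ → ℝ) →ₗ[ℝ] (Fin n₂ → ℝ)) : Prop :=
  (∀ q x, R₂.A q *ᵥ S x = S (R₁.A q *ᵥ x)) ∧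
  (∀ q u, R₂.B q *ᵥ u = S (R₁.B q *ᵥ u)) ∧
  (∀ q x, R₂.C q *ᵥ S x = R₁.C q *ᵥ x) ∧
  ∀ f, S (R₁.μ f) = R₂.μ f

def Isomorphic {n₁ n₂ : ℕ} (R₁ : Realization Φ n₁) (R₂ : Realization Φ n₂) : Prop :=
  ∃ S : (Fin n₁ → ℝ) ≃ₗ[ℝ] (Fin n₂ → ℝ), IsMorphism R₁ R₂ S.toLinearMap

/-- `R` is a result of the column-space algorithm applied to `H_{Φ,N,N+1}` with the isomorphism `φ`
from the column space to `ℝ^n`: it satisfies the equations which define the matrices `B_q`, `C_q`,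
`A_q` and the map `μ`. -/
def IsAlgorithmOutput (R : Realization Φ n) (f₀ : Φ) (N : ℕ)
    (φ : colSpace Φ f₀ N (N + 1) ≃ₗ[ℝ] (Fin n → ℝ)) : Prop :=
  (∀ q j, (R.B q).col j = φ (colVec Φ f₀ N (N + 1) (emptyWord (N + 1)) (Sum.inr (q, j)))) ∧
  (∀ q w j, R.C q *ᵥ φ (colVec Φ f₀ N (N + 1) w j) =
    fun r => subHankel Φ f₀ N (N + 1) (emptyWord N, (q, r)) (w, j)) ∧
  (∀ q (w : Words Q N) j,
    φ.symm (R.A q *ᵥ φ (colVec Φ f₀ N (N + 1) w.lift j)) =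
      colVec Φ f₀ N (N + 1) (w.snoc q) j) ∧
  ∀ f : Φ, R.μ f = φ (colVec Φ f₀ N (N + 1) (emptyWord (N + 1)) (Sum.inl f))

end Realization

end SwitchedSystem

end

/-!
Factor `H_{Φ,L,M}` through the state-space: a `K`-partial realization with `K ≥ L + M` writes it as
the truncated observability map `x ↦ (C_q A_v x)` composed with the vectors `A_w b`, where `b` runs
over the `μ(f)` and the `B_q e_j`. Hence its dimension is at least `rank H_{Φ,L,M}`, and if equality
holds, then the `A_w b` span the state-space and the observability map is a bijection onto the
column space. Two such realizations are therefore both isomorphic to the column space. They are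
semi-reachable and observable, since under a constant input the velocities at time `0` of the
trajectories lie in every subspace which contains the trajectories, so that the spans of the
differences of reached states are invariant under the `A_q`.

Conversely, `rank H_{Φ,N,N} = rank H_{Φ,N+1,N}` means that deleting the rows of length `N + 1` is
injective on the column space of `H_{Φ,N+1,N}`, so that sending the column of `w` to the column of
`wq` extends to a linear map; it takes values in the column space of `H_{Φ,N,N+1}`, which by the
second rank condition is that of `H_{Φ,N,N}`. These maps are the `A_q` of the algorithm. Its output
factors `H_{Φ,N,N+1}`, which contains all the Markov parameters of order at most `2N + 1`.
-/

namespace SwitchedSystem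

section LinearODE

variable {E : Type*} [NormedAddCommGroup E]

theorem mem_of_hasDerivWithinAt {𝕜 : Type*} [NontriviallyNormedField 𝕜] [NormedSpace 𝕜 E]
    {V : Submodule 𝕜 E} (hV : IsClosed (V : Set E)) {ξ : 𝕜 → E} {x : E} {s : Set 𝕜} {a : 𝕜}
    (hs : UniqueDiffWithinAt 𝕜 s a) (hξ : HasDerivWithinAt ξ x s a) (hmem : ∀ t ∈ s, ξ t ∈ V) :
    x ∈ V := by
  rw [← hξ.derivWithin hs]
  have hle : Submodule.span 𝕜 (ξ '' s) ≤ V := Submodule.span_le.2 (Set.image_subset_iff.2 hmem)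
  exact closure_minimal hle hV <| range_derivWithin_subset_closure_span_image ξ
    (subset_closure.trans_eq (by rw [Set.inter_self])) (Set.mem_range_self a)

variable [NormedSpace ℝ E]

theorem exists_hasDerivAt_affine [CompleteSpace E] (L : E →L[ℝ] E) (b x : E) :
    ∃ ξ : ℝ → E, ξ 0 = x ∧ ∀ t, HasDerivAt ξ (L (ξ t) + b) t := by
  -- The velocity of an affine flow is a linear flow, so the solution is its primitive.
  let η : ℝ → E := fun s => NormedSpace.exp (s • L) (L x + b)
  have hη : ∀ s, HasDerivAt η (L (η s)) s := fun s => by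
    simpa [η] using (hasDerivAt_exp_smul_const' (𝕂 := ℝ) L s).clm_apply
      (hasDerivAt_const s (L x + b))
  have hηc : Continuous η := continuous_iff_continuousAt.2 fun s => (hη s).continuousAt
  have hvel : ∀ t, L (x + ∫ s in (0 : ℝ)..t, η s) + b = η t := fun t => by
    rw [map_add, ← L.intervalIntegral_comp_comm (hηc.intervalIntegrable _ _),
      intervalIntegral.integral_eq_sub_of_hasDerivAt (fun s _ => hη s)
        ((L.continuous.comp hηc).intervalIntegrable _ _)]
    simp only [η, zero_smul, NormedSpace.exp_zero, one_apply_eq_self]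
    abel
  refine ⟨fun t => x + ∫ s in (0 : ℝ)..t, η s, by simp, fun t => ?_⟩
  rw [hvel]
  exact (hηc.integral_hasStrictDerivAt 0 t).hasDerivAt.const_add x

theorem hasDerivWithinAt_Ici_of_hasDerivAt_Ioi {v : E → E} (hv : Continuous v) {ξ : ℝ → E}
    {a : ℝ} (hc : ContinuousOn ξ (Set.Ici a)) (hd : ∀ s, a < s → HasDerivAt ξ (v (ξ s)) s)
    {t : ℝ} (ht : a ≤ t) : HasDerivWithinAt ξ (v (ξ t)) (Set.Ici t) t := by
  rcases ht.eq_or_lt with rfl | hlt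
  · have hξ : ContinuousWithinAt ξ (Set.Ioi a) a :=
      (hc a Set.self_mem_Ici).mono Set.Ioi_subset_Ici_self
    refine hasDerivWithinAt_Ici_of_tendsto_deriv
      (fun s hs => (hd s hs).differentiableAt.differentiableWithinAt) hξ self_mem_nhdsWithin ?_
    refine ((hv.tendsto _).comp hξ).congr' ?_
    filter_upwards [self_mem_nhdsWithin] with s hs using (hd s hs).deriv.symm
  · exact (hd t hlt).hasDerivWithinAt

theorem eqOn_Ici_of_hasDerivAt_Ioi {v : E → E} {K : ℝ≥0} (hv : LipschitzWith K v)
    {ξ η : ℝ → E} {a : ℝ} (hξc : ContinuousOn ξ (Set.Ici a))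
    (hξ : ∀ s, a < s → HasDerivAt ξ (v (ξ s)) s) (hηc : ContinuousOn η (Set.Ici a))
    (hη : ∀ s, a < s → HasDerivAt η (v (η s)) s) (h : ξ a = η a) :
    Set.EqOn ξ η (Set.Ici a) := fun _ ht =>
  ODE_solution_unique_of_mem_Icc_right (v := fun _ => v) (s := fun _ => Set.univ)
    (fun _ _ => hv.lipschitzOnWith)
    (hξc.mono Set.Icc_subset_Ici_self)
    (fun _ hs => hasDerivWithinAt_Ici_of_hasDerivAt_Ioi hv.continuous hξc hξ hs.1)
    (fun _ _ => Set.mem_univ _)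
    (hηc.mono Set.Icc_subset_Ici_self)
    (fun _ hs => hasDerivWithinAt_Ici_of_hasDerivAt_Ioi hv.continuous hηc hη hs.1)
    (fun _ _ => Set.mem_univ _) h (Set.right_mem_Icc.2 ht)

end LinearODE

namespace LSS

variable {Q : Type*} {n m p : ℕ}

section WordProd

variable (S : LSS Q n m p)

@[simp]
theorem wordProd_nil : S.wordProd [] = 1 := rfl

theorem wordProd_append (w v : List Q) :
    S.wordProd (w ++ v) = S.wordProd v * S.wordProd w := by
  simp [wordProd]

theorem wordProd_cons (q : Q) (w : List Q) : S.wordProd (q :: w) = S.wordProd w * S.A q := by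
  simp [wordProd]

theorem wordProd_concat (w : List Q) (q : Q) :
    S.wordProd (w ++ [q]) = S.A q * S.wordProd w := by
  simp [wordProd]

theorem wordProd_mulVec_mem {V : Submodule ℝ (Fin n → ℝ)} (hV : ∀ q, ∀ x ∈ V, S.A q *ᵥ x ∈ V)
    (w : List Q) {x : Fin n → ℝ} (hx : x ∈ V) : S.wordProd w *ᵥ x ∈ V := by
  induction w generalizing x with
  | nil => simpa using hx
  | cons q w ih =>
    rw [wordProd_cons, ← Matrix.mulVec_mulVec]
    exact ih (hV q x hx)

end WordProd

section ConstantInput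

variable {S : LSS Q n m p} {q : Q} {c : Fin m → ℝ}

theorem isSolution_const_iff {τ : ℝ≥0} {ξ : ℝ → (Fin n → ℝ)} :
    S.IsSolution q (PC.const c) τ ξ ↔ ContinuousOn ξ (Set.Ici 0) ∧
      ∀ s : ℝ, 0 < s → HasDerivAt ξ (S.A q *ᵥ ξ s + S.B q *ᵥ c) s := by
  refine and_congr_right fun _ => ⟨fun h s hs => ?_, fun h s hs _ => h s hs⟩
  lift s to ℝ≥0 using hs.le
  exact h s hs continuousAt_const

theorem exists_isSolution_const (S : LSS Q n m p) (q : Q) (c : Fin m → ℝ) (x : Fin n → ℝ) :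
    ∃ ξ : ℝ → (Fin n → ℝ), ξ 0 = x ∧ (∀ τ, S.IsSolution q (PC.const c) τ ξ) ∧
      HasDerivAt ξ (S.A q *ᵥ x + S.B q *ᵥ c) 0 := by
  obtain ⟨ξ, rfl, hξ⟩ :=
    exists_hasDerivAt_affine (LinearMap.toContinuousLinearMap (S.A q).mulVecLin) (S.B q *ᵥ c) x
  have hc : Continuous ξ := continuous_iff_continuousAt.2 fun s => (hξ s).continuousAt
  exact ⟨ξ, rfl, fun τ => isSolution_const_iff.2 ⟨hc.continuousOn, fun s _ => hξ s⟩, hξ 0⟩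

theorem IsSolution.eqOn_of_const {τ : ℝ≥0} {ξ η : ℝ → (Fin n → ℝ)}
    (hξ : S.IsSolution q (PC.const c) τ ξ) (hη : S.IsSolution q (PC.const c) τ η)
    (h : ξ 0 = η 0) : Set.EqOn ξ η (Set.Ici 0) := by
  rw [isSolution_const_iff] at hξ hη
  have hv : LipschitzWith _ fun x => S.A q *ᵥ x + S.B q *ᵥ c :=
    (LinearMap.toContinuousLinearMap (S.A q).mulVecLin).lipschitz.add
      (LipschitzWith.const (S.B q *ᵥ c))
  exact eqOn_Ici_of_hasDerivAt_Ioi hv hξ.1 hξ.2 hη.1 hη.2 h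

theorem StateAt.eq_of_const {w : List (Q × ℝ≥0)} {τ : ℝ≥0} {x₀ x x' : Fin n → ℝ}
    (h : S.StateAt (PC.const c) τ w x₀ x) (h' : S.StateAt (PC.const c) τ w x₀ x') : x = x' := by
  induction w generalizing τ x₀ with
  | nil => exact h.trans h'.symm
  | cons a w ih =>
    obtain ⟨ξ, hξ, hξ₀, h⟩ := h
    obtain ⟨η, hη, hη₀, h'⟩ := h'
    have hend : ξ a.2 = η a.2 := hξ.eqOn_of_const hη (hξ₀.trans hη₀.symm) a.2.2
    rw [hend] at h
    exact ih h h'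

theorem StateAt.concat_const {ξ : ℝ → (Fin n → ℝ)} (hξ : ∀ τ, S.IsSolution q (PC.const c) τ ξ)
    {w : List (Q × ℝ≥0)} {τ : ℝ≥0} {x₀ : Fin n → ℝ}
    (h : S.StateAt (PC.const c) τ w x₀ (ξ 0)) (t : ℝ≥0) :
    S.StateAt (PC.const c) τ (w ++ [(q, t)]) x₀ (ξ t) := by
  induction w generalizing τ x₀ with
  | nil => exact ⟨ξ, hξ τ, h, rfl⟩
  | cons a w ih =>
    obtain ⟨η, hη, hη₀, h⟩ := h
    exact ⟨η, hη, hη₀, ih h⟩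

theorem StateAt.concat_zero {w : List (Q × ℝ≥0)} {τ : ℝ≥0} {x₀ x : Fin n → ℝ}
    (h : S.StateAt (PC.const c) τ w x₀ x) (q : Q) :
    S.StateAt (PC.const c) τ (w ++ [(q, 0)]) x₀ x := by
  obtain ⟨ξ, rfl, hξ, -⟩ := S.exists_isSolution_const q c x
  simpa using h.concat_const hξ 0

end ConstantInput

section Reachability

variable {S : LSS Q n m p} {c : Fin m → ℝ} {x₀ : Fin n → ℝ}

/-- The states which can be reached from `x₀` under the constant input `c`. The empty switching
sequence is allowed, so that `x₀` itself is one of them. -/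
def constReach (S : LSS Q n m p) (c : Fin m → ℝ) (x₀ : Fin n → ℝ) : Set (Fin n → ℝ) :=
  {x | ∃ w : List (Q × ℝ≥0), S.StateAt (PC.const c) 0 w x₀ x}

theorem self_mem_constReach : x₀ ∈ S.constReach c x₀ := ⟨[], rfl⟩

theorem constReach_subset_reach [Nonempty Q] {X₀ : Set (Fin n → ℝ)} (hx₀ : x₀ ∈ X₀) :
    S.constReach c x₀ ⊆ S.reach X₀ := by
  rintro x ⟨w, hw⟩
  obtain ⟨q⟩ := ‹Nonempty Q›
  exact ⟨x₀, hx₀, PC.const c, ⟨w ++ [(q, 0)], by simp⟩, hw.concat_zero q⟩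

theorem vectorSpan_constReach_le [Nonempty Q] {X₀ : Set (Fin n → ℝ)} (hx₀ : x₀ ∈ X₀) :
    vectorSpan ℝ (S.constReach c x₀) ≤ Submodule.span ℝ (S.reach X₀) := by
  refine Submodule.span_le.2 ?_
  rintro _ ⟨x, hx, y, hy, rfl⟩
  have hreach := constReach_subset_reach (S := S) (c := c) hx₀
  exact Submodule.sub_mem _ (Submodule.subset_span (hreach hx)) (Submodule.subset_span (hreach hy))

theorem velocity_mem_vectorSpan_constReach (q : Q) {x : Fin n → ℝ}
    (hx : x ∈ S.constReach c x₀) :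
    S.A q *ᵥ x + S.B q *ᵥ c ∈ vectorSpan ℝ (S.constReach c x₀) := by
  obtain ⟨w, hw⟩ := hx
  obtain ⟨ξ, rfl, hξ, hd⟩ := S.exists_isSolution_const q c x
  refine mem_of_hasDerivWithinAt (Submodule.closed_of_finiteDimensional _)
    (uniqueDiffOn_Ici 0 0 Set.self_mem_Ici) (hd.sub_const (ξ 0)).hasDerivWithinAt fun t ht => ?_
  lift t to ℝ≥0 using ht
  exact vsub_mem_vectorSpan ℝ ⟨_, hw.concat_const hξ t⟩ ⟨w, hw⟩

theorem mulVec_mem_vectorSpan_constReach (q : Q) {x : Fin n → ℝ}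
    (hx : x ∈ vectorSpan ℝ (S.constReach c x₀)) :
    S.A q *ᵥ x ∈ vectorSpan ℝ (S.constReach c x₀) := by
  suffices hle : vectorSpan ℝ (S.constReach c x₀) ≤
      (vectorSpan ℝ (S.constReach c x₀)).comap (S.A q).mulVecLin from hle hx
  refine Submodule.span_le.2 ?_
  rintro _ ⟨x, hx, y, hy, rfl⟩
  simpa [Matrix.mulVec_sub] using Submodule.sub_mem _
    (velocity_mem_vectorSpan_constReach q hx) (velocity_mem_vectorSpan_constReach q hy)

theorem wordProd_velocity_mem_span_reach {X₀ : Set (Fin n → ℝ)} (hx₀ : x₀ ∈ X₀) (q : Q)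
    (c : Fin m → ℝ) (w : List Q) :
    S.wordProd w *ᵥ (S.A q *ᵥ x₀ + S.B q *ᵥ c) ∈ Submodule.span ℝ (S.reach X₀) :=
  haveI : Nonempty Q := ⟨q⟩
  vectorSpan_constReach_le hx₀ <| S.wordProd_mulVec_mem
    (fun q _ => mulVec_mem_vectorSpan_constReach q) w
    (velocity_mem_vectorSpan_constReach q self_mem_constReach)

theorem wordProd_mulVec_mem_span_reach [Nonempty Q] {X₀ : Set (Fin n → ℝ)} (hx₀ : x₀ ∈ X₀)
    (w : List Q) : S.wordProd w *ᵥ x₀ ∈ Submodule.span ℝ (S.reach X₀) := by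
  cases w with
  | nil =>
    simpa using Submodule.subset_span (R := ℝ)
      (constReach_subset_reach (S := S) (c := 0) hx₀ self_mem_constReach)
  | cons q w =>
    simpa [wordProd_cons] using S.wordProd_velocity_mem_span_reach hx₀ q 0 w

theorem wordProd_mulVec_input_mem_span_reach {X₀ : Set (Fin n → ℝ)} (hx₀ : x₀ ∈ X₀) (q : Q)
    (c : Fin m → ℝ) (w : List Q) :
    S.wordProd w *ᵥ (S.B q *ᵥ c) ∈ Submodule.span ℝ (S.reach X₀) := by
  simpa [Matrix.mulVec_add] using Submodule.sub_mem _
    (S.wordProd_velocity_mem_span_reach hx₀ q c w) (S.wordProd_velocity_mem_span_reach hx₀ q 0 w)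

end Reachability

section Observability

variable {S : LSS Q n m p} {c : Fin m → ℝ} {x₁ x₂ : Fin n → ℝ}

/-- The differences of the states which are reached from `x₁` and from `x₂` under the constant
input `c` by the same switching sequence, possibly the empty one. -/
def constReachDiff (S : LSS Q n m p) (c : Fin m → ℝ) (x₁ x₂ : Fin n → ℝ) : Set (Fin n → ℝ) :=
  {d | ∃ (w : List (Q × ℝ≥0)) (y₁ y₂ : Fin n → ℝ), S.StateAt (PC.const c) 0 w x₁ y₁ ∧
    S.StateAt (PC.const c) 0 w x₂ y₂ ∧ y₁ - y₂ = d}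

theorem sub_mem_constReachDiff : x₁ - x₂ ∈ S.constReachDiff c x₁ x₂ :=
  ⟨[], x₁, x₂, rfl, rfl, rfl⟩

theorem mulVec_mem_span_constReachDiff (q : Q) {x : Fin n → ℝ}
    (hx : x ∈ Submodule.span ℝ (S.constReachDiff c x₁ x₂)) :
    S.A q *ᵥ x ∈ Submodule.span ℝ (S.constReachDiff c x₁ x₂) := by
  suffices hle : Submodule.span ℝ (S.constReachDiff c x₁ x₂) ≤
      (Submodule.span ℝ (S.constReachDiff c x₁ x₂)).comap (S.A q).mulVecLin from hle hx
  refine Submodule.span_le.2 ?_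
  rintro _ ⟨w, y₁, y₂, h₁, h₂, rfl⟩
  obtain ⟨ξ₁, rfl, hξ₁, hd₁⟩ := S.exists_isSolution_const q c y₁
  obtain ⟨ξ₂, rfl, hξ₂, hd₂⟩ := S.exists_isSolution_const q c y₂
  have hd := hd₁.sub hd₂
  rw [add_sub_add_right_eq_sub, ← Matrix.mulVec_sub] at hd
  change S.A q *ᵥ (ξ₁ 0 - ξ₂ 0) ∈ Submodule.span ℝ (S.constReachDiff c x₁ x₂)
  refine mem_of_hasDerivWithinAt (Submodule.closed_of_finiteDimensional _)
    (uniqueDiffOn_Ici 0 0 Set.self_mem_Ici) hd.hasDerivWithinAt fun t ht => ?_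
  lift t to ℝ≥0 using ht
  exact Submodule.subset_span
    ⟨_, ξ₁ t, ξ₂ t, h₁.concat_const hξ₁ t, h₂.concat_const hξ₂ t, rfl⟩

theorem Indistinguishable.mulVec_eq_zero (h : S.Indistinguishable x₁ x₂) (q : Q)
    {x : Fin n → ℝ} (hx : x ∈ Submodule.span ℝ (S.constReachDiff c x₁ x₂)) :
    S.C q *ᵥ x = 0 := by
  suffices hle : Submodule.span ℝ (S.constReachDiff c x₁ x₂) ≤ LinearMap.ker (S.C q).mulVecLin
    from hle hx
  refine Submodule.span_le.2 ?_
  rintro _ ⟨w, y₁, y₂, h₁, h₂, rfl⟩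
  obtain ⟨y, hy, hC⟩ := (h (PC.const c) ⟨w ++ [(q, 0)], by simp⟩ _).1 ⟨y₁, h₁.concat_zero q, rfl⟩
  obtain rfl : y = y₂ := StateAt.eq_of_const hy (h₂.concat_zero q)
  simpa [Matrix.mulVec_sub, sub_eq_zero] using hC

theorem Indistinguishable.wordProd_mulVec_eq_zero (h : S.Indistinguishable x₁ x₂) (q : Q)
    (w : List Q) : S.C q *ᵥ (S.wordProd w *ᵥ (x₁ - x₂)) = 0 :=
  h.mulVec_eq_zero (c := 0) q <| S.wordProd_mulVec_mem
    (fun q _ => mulVec_mem_span_constReachDiff q) w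
    (Submodule.subset_span sub_mem_constReachDiff)

end Observability

end LSS

section LinearAlgebra

variable {K : Type*}

theorem mulVec_ext_of_span_eq_top [CommSemiring K] {m n : Type*} [Fintype n] {A B : Matrix m n K}
    {s : Set (n → K)} (hs : Submodule.span K s = ⊤) (h : ∀ x ∈ s, A *ᵥ x = B *ᵥ x) : A = B :=
  Matrix.mulVec_injective <| congrArg DFunLike.coe <|
    LinearMap.ext_on (f := A.mulVecLin) (g := B.mulVecLin) hs h

theorem exists_linearEquiv_apply_eq_of_range_eq [Ring K] {U V W : Type*} [AddCommGroup U]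
    [Module K U] [AddCommGroup V] [Module K V] [AddCommGroup W] [Module K W] {f : U →ₗ[K] W}
    {g : V →ₗ[K] W} (hf : Function.Injective f) (hg : Function.Injective g)
    (h : LinearMap.range f = LinearMap.range g) : ∃ e : U ≃ₗ[K] V, ∀ x, g (e x) = f x := by
  let eg := LinearEquiv.ofInjective g hg
  refine ⟨(LinearEquiv.ofInjective f hf).trans ((LinearEquiv.ofEq _ _ h).trans eg.symm),
    fun x => ?_⟩
  exact congrArg Subtype.val (eg.apply_symm_apply _)

end LinearAlgebra

section HankelMatrix

variable {Q : Type*} {m p : ℕ} {Φ : Set (IOMap Q m p)} {f₀ : Φ}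

instance Words.instFinite [Finite Q] (L : ℕ) : Finite (Words Q L) :=
  (List.finite_length_le Q L).to_subtype

/-- The word `qv`, which labels a row of the Hankel matrix. -/
def Words.cons {L : ℕ} (q : Q) (v : Words Q L) : Words Q (L + 1) :=
  ⟨q :: v.1, by simpa using v.2⟩

theorem hankel_eq_of_append_eq {v v' w w' : List Q} (h : w ++ v = w' ++ v') (i : Q × Fin p)
    (j : ColIdx Φ) : hankel Φ f₀ (v, i) (w, j) = hankel Φ f₀ (v', i) (w', j) := by
  rcases j with f | ⟨q₀, j⟩ <;> simp only [hankel, h]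

theorem span_range_colVec (L M : ℕ) :
    Submodule.span ℝ (Set.range fun x : Words Q M × ColIdx Φ => colVec Φ f₀ L M x.1 x.2) = ⊤ := by
  refine Submodule.map_injective_of_injective (colSpace Φ f₀ L M).injective_subtype ?_
  rw [Submodule.map_span, ← Set.range_comp, Submodule.map_subtype_top]
  rfl

theorem colSpace_le_comap_lift (L M : ℕ) : colSpace Φ f₀ (L + 1) M ≤ (colSpace Φ f₀ L M).comap
    (LinearMap.funLeft ℝ ℝ fun i : Words Q L × (Q × Fin p) => (i.1.lift, i.2)) := by
  refine Submodule.span_le.2 ?_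
  rintro _ ⟨⟨w, j⟩, rfl⟩
  exact Submodule.subset_span ⟨(w, j), rfl⟩

variable (Φ f₀) in
/-- The linear map from the column space of `H_{Φ,L+1,M}` onto that of `H_{Φ,L,M}` which forgets
the rows `v` with `|v| = L + 1`. -/
def truncateRows (L M : ℕ) : colSpace Φ f₀ (L + 1) M →ₗ[ℝ] colSpace Φ f₀ L M :=
  (LinearMap.funLeft ℝ ℝ fun i : Words Q L × (Q × Fin p) => (i.1.lift, i.2)).restrict
    fun _ hx => colSpace_le_comap_lift L M hx

theorem truncateRows_colVec {L M : ℕ} (w : Words Q M) (j : ColIdx Φ) :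
    truncateRows Φ f₀ L M (colVec Φ f₀ (L + 1) M w j) = colVec Φ f₀ L M w j := rfl

theorem funLeft_cons_col {L M : ℕ} (q : Q) (w : Words Q M) (j : ColIdx Φ) :
    LinearMap.funLeft ℝ ℝ (fun i : Words Q L × (Q × Fin p) => (i.1.cons q, i.2))
      ((subHankel Φ f₀ (L + 1) M).col (w, j)) = (subHankel Φ f₀ L (M + 1)).col (w.snoc q, j) := by
  ext i
  exact hankel_eq_of_append_eq (by simp [Words.cons, Words.snoc]) i.2 j

theorem colSpace_le_comap_cons (L M : ℕ) (q : Q) :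
    colSpace Φ f₀ (L + 1) M ≤ (colSpace Φ f₀ L (M + 1)).comap
      (LinearMap.funLeft ℝ ℝ fun i : Words Q L × (Q × Fin p) => (i.1.cons q, i.2)) := by
  refine Submodule.span_le.2 ?_
  rintro _ ⟨⟨w, j⟩, rfl⟩
  exact Submodule.subset_span ⟨(w.snoc q, j), (funLeft_cons_col q w j).symm⟩

variable (Φ f₀) in
/-- The linear map from the column space of `H_{Φ,L+1,M}` to that of `H_{Φ,L,M+1}` which reads off
the rows `qv`; by the Hankel structure it sends the column of `w` to the column of `wq`. -/
def shiftRows (L M : ℕ) (q : Q) : colSpace Φ f₀ (L + 1) M →ₗ[ℝ] colSpace Φ f₀ L (M + 1) :=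
  (LinearMap.funLeft ℝ ℝ fun i : Words Q L × (Q × Fin p) => (i.1.cons q, i.2)).restrict
    fun _ hx => colSpace_le_comap_cons L M q hx

theorem shiftRows_colVec {L M : ℕ} (q : Q) (w : Words Q M) (j : ColIdx Φ) :
    shiftRows Φ f₀ L M q (colVec Φ f₀ (L + 1) M w j) = colVec Φ f₀ L (M + 1) (w.snoc q) j :=
  Subtype.ext (funLeft_cons_col q w j)

theorem truncateRows_surjective (L M : ℕ) : Function.Surjective (truncateRows Φ f₀ L M) := by
  rw [← LinearMap.range_eq_top, eq_top_iff, ← span_range_colVec]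
  refine Submodule.span_le.2 ?_
  rintro _ ⟨⟨w, j⟩, rfl⟩
  exact ⟨colVec Φ f₀ (L + 1) M w j, truncateRows_colVec w j⟩

theorem truncateRows_bijective {L M : ℕ} [FiniteDimensional ℝ (colSpace Φ f₀ (L + 1) M)]
    (h : hankelRank Φ f₀ L M = hankelRank Φ f₀ (L + 1) M) :
    Function.Bijective (truncateRows Φ f₀ L M) := by
  have hsurj := truncateRows_surjective (Φ := Φ) (f₀ := f₀) L M
  have := Module.Finite.of_surjective _ hsurj
  exact ⟨(LinearMap.injective_iff_surjective_of_finrank_eq_finrank h.symm).2 hsurj, hsurj⟩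

theorem exists_columnShift {L M : ℕ} [FiniteDimensional ℝ (colSpace Φ f₀ (L + 1) M)]
    (h : hankelRank Φ f₀ L M = hankelRank Φ f₀ (L + 1) M) (q : Q) :
    ∃ T : colSpace Φ f₀ L M →ₗ[ℝ] colSpace Φ f₀ L (M + 1), ∀ w j,
      T (colVec Φ f₀ L M w j) = colVec Φ f₀ L (M + 1) (w.snoc q) j := by
  let e := LinearEquiv.ofBijective _ (truncateRows_bijective h)
  refine ⟨shiftRows Φ f₀ L M q ∘ₗ e.symm.toLinearMap, fun w j => ?_⟩
  have he : e.symm (colVec Φ f₀ L M w j) = colVec Φ f₀ (L + 1) M w j :=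
    e.symm_apply_eq.2 (truncateRows_colVec w j).symm
  rw [LinearMap.comp_apply, LinearEquiv.coe_coe, he, shiftRows_colVec]

theorem colSpace_le_succ (L M : ℕ) : colSpace Φ f₀ L M ≤ colSpace Φ f₀ L (M + 1) := by
  refine Submodule.span_mono ?_
  rintro _ ⟨⟨w, j⟩, rfl⟩
  exact ⟨(w.lift, j), rfl⟩

theorem colSpace_eq_succ {L M : ℕ} [FiniteDimensional ℝ (colSpace Φ f₀ L (M + 1))]
    (h : hankelRank Φ f₀ L M = hankelRank Φ f₀ L (M + 1)) :
    colSpace Φ f₀ L M = colSpace Φ f₀ L (M + 1) :=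
  Submodule.eq_of_le_of_finrank_eq (colSpace_le_succ L M) h

theorem span_range_colVec_lift {L M : ℕ} (h : colSpace Φ f₀ L M = colSpace Φ f₀ L (M + 1)) :
    Submodule.span ℝ (Set.range fun x : Words Q M × ColIdx Φ =>
      colVec Φ f₀ L (M + 1) x.1.lift x.2) = ⊤ := by
  refine Submodule.map_injective_of_injective (colSpace Φ f₀ L (M + 1)).injective_subtype ?_
  rw [Submodule.map_span, ← Set.range_comp, Submodule.map_subtype_top]
  exact h

end HankelMatrix

namespace Realization

variable {Q : Type*} {m p n : ℕ} {Φ : Set (IOMap Q m p)} {f₀ : Φ}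

section Factorization

/-- The vectors `μ(f)` and `B_q e_j`, which generate the reachable space under the `A_q`. -/
def gen (R : Realization Φ n) : ColIdx Φ → (Fin n → ℝ)
  | Sum.inl f => R.μ f
  | Sum.inr (q, j) => (R.B q).col j

/-- The span of the vectors `A_w b` over the words `w` of length at most `M` and the generators
`b`. -/
def genSpan (R : Realization Φ n) (M : ℕ) : Submodule ℝ (Fin n → ℝ) :=
  Submodule.span ℝ (Set.range fun x : Words Q M × ColIdx Φ => R.wordProd x.1.1 *ᵥ R.gen x.2)

/-- The truncated observability map, which sends `x` to the vectors `C_q A_v x` over the words `v`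
of length at most `L`. -/
def obsMap (R : Realization Φ n) (L : ℕ) : (Fin n → ℝ) →ₗ[ℝ] (Words Q L × (Q × Fin p) → ℝ) :=
  LinearMap.pi fun i => LinearMap.proj i.2.2 ∘ₗ (R.C i.2.1 * R.wordProd i.1.1).mulVecLin

theorem obsMap_apply (R : Realization Φ n) (L : ℕ) (x : Fin n → ℝ)
    (i : Words Q L × (Q × Fin p)) :
    R.obsMap L x i = (R.C i.2.1 *ᵥ (R.wordProd i.1.1 *ᵥ x)) i.2.2 := by
  simp [obsMap]

theorem isPartialRealization_iff (R : Realization Φ n) (K : ℕ) :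
    R.IsPartialRealization f₀ K ↔ ∀ w : List Q, w.length ≤ K → ∀ (q : Q) (r : Fin p)
      (j : ColIdx Φ), hankel Φ f₀ ([], (q, r)) (w, j) =
        (R.C q *ᵥ (R.wordProd w *ᵥ R.gen j)) r := by
  simp only [IsPartialRealization, hankel, gen, List.append_nil, Sum.forall, Prod.forall,
    Matrix.mulVec_mulVec, ← Matrix.mulVec_single_one, Matrix.mul_assoc, funext_iff]
  grind

variable {R : Realization Φ n} {K L M : ℕ}

theorem IsPartialRealization.obsMap_gen (h : R.IsPartialRealization f₀ K) (hK : M + L ≤ K)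
    (w : Words Q M) (j : ColIdx Φ) :
    R.obsMap L (R.wordProd w.1 *ᵥ R.gen j) = (subHankel Φ f₀ L M).col (w, j) := by
  ext ⟨v, q, r⟩
  have hlen : (w.1 ++ v.1).length ≤ K := by
    simpa using (add_le_add w.2 v.2).trans hK
  rw [obsMap_apply, Matrix.mulVec_mulVec _ (R.wordProd v.1), ← LSS.wordProd_append,
    ← (R.isPartialRealization_iff K).1 h _ hlen]
  exact hankel_eq_of_append_eq (by simp) (q, r) j

theorem isPartialRealization_of_obsMap_gen (hK : K ≤ M + L)
    (h : ∀ (w : Words Q M) (j : ColIdx Φ),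
      R.obsMap L (R.wordProd w.1 *ᵥ R.gen j) = (subHankel Φ f₀ L M).col (w, j)) :
    R.IsPartialRealization f₀ K := by
  rw [isPartialRealization_iff]
  intro u hu q r j
  obtain ⟨w, v, rfl, hw, hv⟩ : ∃ w v, w ++ v = u ∧ w.length ≤ M ∧ v.length ≤ L :=
    ⟨u.take M, u.drop M, List.take_append_drop M u, by simp, by simp; omega⟩
  rw [LSS.wordProd_append, ← Matrix.mulVec_mulVec, hankel_eq_of_append_eq (List.append_nil _)]
  exact (congrFun (h ⟨w, hw⟩ j) (⟨v, hv⟩, (q, r))).symm.trans (obsMap_apply ..)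

theorem IsPartialRealization.map_obsMap_genSpan (h : R.IsPartialRealization f₀ K)
    (hK : M + L ≤ K) : (R.genSpan M).map (R.obsMap L) = colSpace Φ f₀ L M := by
  rw [genSpan, colSpace, Submodule.map_span, ← Set.range_comp]
  congr 2
  ext1 x
  exact h.obsMap_gen hK x.1 x.2

theorem IsPartialRealization.hankelRank_le_finrank_genSpan (h : R.IsPartialRealization f₀ K)
    (hK : M + L ≤ K) : hankelRank Φ f₀ L M ≤ Module.finrank ℝ (R.genSpan M) := by
  rw [hankelRank, ← h.map_obsMap_genSpan hK]
  exact Submodule.finrank_map_le _ _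

theorem IsPartialRealization.hankelRank_le (h : R.IsPartialRealization f₀ K)
    (hK : M + L ≤ K) : hankelRank Φ f₀ L M ≤ n :=
  (h.hankelRank_le_finrank_genSpan hK).trans ((Submodule.finrank_le _).trans_eq (by simp))

theorem IsPartialRealization.genSpan_eq_top (h : R.IsPartialRealization f₀ K)
    (hK : M + L ≤ K) (hn : n ≤ hankelRank Φ f₀ L M) : R.genSpan M = ⊤ := by
  refine Submodule.eq_top_of_finrank_eq (le_antisymm (Submodule.finrank_le _) ?_)
  simpa using hn.trans (h.hankelRank_le_finrank_genSpan hK)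

theorem IsPartialRealization.range_obsMap (h : R.IsPartialRealization f₀ K)
    (hK : M + L ≤ K) (hn : n ≤ hankelRank Φ f₀ L M) :
    LinearMap.range (R.obsMap L) = colSpace Φ f₀ L M := by
  rw [← Submodule.map_top, ← h.genSpan_eq_top hK hn, h.map_obsMap_genSpan hK]

theorem IsPartialRealization.obsMap_injective (h : R.IsPartialRealization f₀ K)
    (hK : M + L ≤ K) (hn : n ≤ hankelRank Φ f₀ L M) : Function.Injective (R.obsMap L) := by
  rw [← LinearMap.ker_eq_bot, ← Submodule.finrank_eq_zero (R := ℝ)]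
  have hrank := (R.obsMap L).finrank_range_add_finrank_ker
  rw [h.range_obsMap hK hn, Module.finrank_fin_fun] at hrank
  change hankelRank Φ f₀ L M + _ = n at hrank
  omega

end Factorization

section ReachabilityObservability

variable {R : Realization Φ n}

theorem isSemiReachable_of_genSpan_eq_top [Nonempty Q] (f₀ : Φ) {M : ℕ}
    (h : R.genSpan M = ⊤) : R.IsSemiReachable := by
  rw [IsSemiReachable, LSS.IsSemiReachableFrom, eq_top_iff, ← h]
  refine Submodule.span_le.2 ?_
  rintro _ ⟨⟨w, f | ⟨q, j⟩⟩, rfl⟩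
  · exact LSS.wordProd_mulVec_mem_span_reach (Set.mem_range_self f) w.1
  · have hmem := LSS.wordProd_mulVec_input_mem_span_reach (S := R.toLSS)
      (Set.mem_range_self (f := R.μ) f₀) q (Pi.single j 1) w.1
    rwa [Matrix.mulVec_single_one] at hmem

theorem isObservable_of_obsMap_injective {L : ℕ} (h : Function.Injective (R.obsMap L)) :
    R.IsObservable := by
  intro x₁ x₂ hx
  rw [← sub_eq_zero, ← map_eq_zero_iff _ h]
  ext ⟨v, q, r⟩
  rw [obsMap_apply, hx.wordProd_mulVec_eq_zero]
  rfl

theorem IsPartialRealization.isSemiReachable {K L M : ℕ} (h : R.IsPartialRealization f₀ K)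
    (hK : M + L ≤ K) (hn : n ≤ hankelRank Φ f₀ L M) : R.IsSemiReachable := by
  rcases isEmpty_or_nonempty Q with _ | _
  · -- Without modes no state is reachable, but then the Hankel matrix has no rows and `n = 0`.
    have := (h.obsMap_injective hK hn).subsingleton
    exact Subsingleton.elim _ _
  · exact isSemiReachable_of_genSpan_eq_top f₀ (h.genSpan_eq_top hK hn)

end ReachabilityObservability

section Isomorphism

variable {n₁ n₂ K L M : ℕ} {R₁ : Realization Φ n₁} {R₂ : Realization Φ n₂}

theorem isMorphism_of_obsMap_eq (h₁ : R₁.IsPartialRealization f₀ K)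
    (h₂ : R₂.IsPartialRealization f₀ K) (hK : M + 1 + L ≤ K) (hspan : R₁.genSpan M = ⊤)
    (hinj : Function.Injective (R₂.obsMap L)) {S : (Fin n₁ → ℝ) →ₗ[ℝ] (Fin n₂ → ℝ)}
    (hS : ∀ x, R₂.obsMap L (S x) = R₁.obsMap L x) : IsMorphism R₁ R₂ S := by
  have hgen : ∀ (w : Words Q (M + 1)) (j : ColIdx Φ),
      S (R₁.wordProd w.1 *ᵥ R₁.gen j) = R₂.wordProd w.1 *ᵥ R₂.gen j := fun w j =>
    hinj <| by rw [hS, h₁.obsMap_gen hK, h₂.obsMap_gen hK]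
  have hgen₀ : ∀ j, S (R₁.gen j) = R₂.gen j := fun j => by
    simpa [emptyWord] using hgen (emptyWord _) j
  have hA : ∀ q, (R₂.A q).mulVecLin ∘ₗ S = S ∘ₗ (R₁.A q).mulVecLin := fun q => by
    refine LinearMap.ext_on hspan ?_
    rintro _ ⟨⟨w, j⟩, rfl⟩
    have hsnoc := hgen (w.snoc q) j
    simp only [Words.snoc, LSS.wordProd_concat, ← Matrix.mulVec_mulVec] at hsnoc
    simp only [LinearMap.comp_apply, Matrix.mulVecLin_apply, hsnoc]
    exact congrArg (R₂.A q *ᵥ ·) (hgen w.lift j)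
  have hB : ∀ q, (R₂.B q).mulVecLin = S ∘ₗ (R₁.B q).mulVecLin := fun q => by
    refine LinearMap.pi_ext' fun j => LinearMap.ext_ring ?_
    simpa [gen] using (hgen₀ (Sum.inr (q, j))).symm
  refine ⟨fun q => LinearMap.congr_fun (hA q), fun q => LinearMap.congr_fun (hB q),
    fun q x => ?_, fun f => hgen₀ (Sum.inl f)⟩
  ext r
  simpa [obsMap_apply, emptyWord] using congrFun (hS x) (emptyWord L, (q, r))

theorem isomorphic_of_le_hankelRank (h₁ : R₁.IsPartialRealization f₀ K)
    (h₂ : R₂.IsPartialRealization f₀ K) (hK : M + 1 + L ≤ K) (hn₁ : n₁ ≤ hankelRank Φ f₀ L M)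
    (hn₂ : n₂ ≤ hankelRank Φ f₀ L M) : R₁.Isomorphic R₂ := by
  have hK' : M + L ≤ K := by omega
  have hinj₂ := h₂.obsMap_injective hK' hn₂
  obtain ⟨S, hS⟩ := exists_linearEquiv_apply_eq_of_range_eq (h₁.obsMap_injective hK' hn₁) hinj₂
    ((h₁.range_obsMap hK' hn₁).trans (h₂.range_obsMap hK' hn₂).symm)
  exact ⟨S, isMorphism_of_obsMap_eq h₁ h₂ hK (h₁.genSpan_eq_top hK' hn₁) hinj₂ hS⟩

end Isomorphism

section Algorithm

variable {N : ℕ} {φ : colSpace Φ f₀ N (N + 1) ≃ₗ[ℝ] (Fin n → ℝ)} {R R' : Realization Φ n}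

theorem IsAlgorithmOutput.A_mulVec (h : R.IsAlgorithmOutput f₀ N φ) (q : Q) (w : Words Q N)
    (j : ColIdx Φ) : R.A q *ᵥ φ (colVec Φ f₀ N (N + 1) w.lift j) =
      φ (colVec Φ f₀ N (N + 1) (w.snoc q) j) :=
  (φ.symm_apply_eq).1 (h.2.2.1 q w j)

theorem IsAlgorithmOutput.wordProd_gen (h : R.IsAlgorithmOutput f₀ N φ) (w : Words Q (N + 1))
    (j : ColIdx Φ) : R.wordProd w.1 *ᵥ R.gen j = φ (colVec Φ f₀ N (N + 1) w j) := by
  obtain ⟨w, hw⟩ := w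
  induction w using List.reverseRecOn with
  | nil =>
    rcases j with f | ⟨q, j⟩
    · simpa [gen, emptyWord] using h.2.2.2 f
    · simpa [gen, emptyWord] using h.1 q j
  | append_singleton w q ih =>
    have hw' : w.length ≤ N := by simpa using hw
    rw [LSS.wordProd_concat, ← Matrix.mulVec_mulVec, ih (hw'.trans N.le_succ)]
    exact h.A_mulVec q ⟨w, hw'⟩ j

theorem IsAlgorithmOutput.obsMap_comp (h : R.IsAlgorithmOutput f₀ N φ)
    (hcol : colSpace Φ f₀ N N = colSpace Φ f₀ N (N + 1)) :
    R.obsMap N ∘ₗ φ.toLinearMap = (colSpace Φ f₀ N (N + 1)).subtype := by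
  suffices hrow : ∀ (v : List Q) (hv : v.length ≤ N) (i : Q × Fin p),
      LinearMap.proj (⟨v, hv⟩, i) ∘ₗ R.obsMap N ∘ₗ φ.toLinearMap =
        LinearMap.proj (⟨v, hv⟩, i) ∘ₗ (colSpace Φ f₀ N (N + 1)).subtype by
    ext x ⟨v, i⟩
    exact LinearMap.congr_fun (hrow v.1 v.2 i) x
  intro v hv ⟨q, r⟩
  induction v with
  | nil =>
    refine LinearMap.ext_on (span_range_colVec_lift hcol) ?_
    rintro _ ⟨⟨w, j⟩, rfl⟩
    simpa [obsMap_apply, colVec, emptyWord] using congrFun (h.2.1 q w.lift j) r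
  | cons q' v ih =>
    refine LinearMap.ext_on (span_range_colVec_lift hcol) ?_
    rintro _ ⟨⟨w, j⟩, rfl⟩
    have hv' : v.length ≤ N := by grind
    have hsnoc := LinearMap.congr_fun (ih hv') (colVec Φ f₀ N (N + 1) (w.snoc q') j)
    simp only [LinearMap.comp_apply, LinearMap.proj_apply, LinearEquiv.coe_coe,
      obsMap_apply] at hsnoc ⊢
    rw [LSS.wordProd_cons, ← Matrix.mulVec_mulVec, h.A_mulVec, hsnoc]
    exact hankel_eq_of_append_eq (by simp [Words.lift, Words.snoc]) (q, r) j

theorem IsAlgorithmOutput.isPartialRealization (h : R.IsAlgorithmOutput f₀ N φ)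
    (hcol : colSpace Φ f₀ N N = colSpace Φ f₀ N (N + 1)) :
    R.IsPartialRealization f₀ (2 * N + 1) := by
  refine isPartialRealization_of_obsMap_gen (L := N) (M := N + 1) (by omega) fun w j => ?_
  rw [h.wordProd_gen]
  exact LinearMap.congr_fun (h.obsMap_comp hcol) _

theorem IsAlgorithmOutput.eq (h : R.IsAlgorithmOutput f₀ N φ)
    (h' : R'.IsAlgorithmOutput f₀ N φ)
    (hcol : colSpace Φ f₀ N N = colSpace Φ f₀ N (N + 1)) : R = R' := by
  have hspan : Submodule.span ℝ (Set.range fun x : Words Q N × ColIdx Φ =>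
      φ (colVec Φ f₀ N (N + 1) x.1.lift x.2)) = ⊤ := by
    have hmap := congrArg (Submodule.map φ.toLinearMap) (span_range_colVec_lift hcol)
    rwa [Submodule.map_span, ← Set.range_comp, Submodule.map_top, LinearEquiv.range] at hmap
  refine Realization.ext (funext fun q => ?_) (funext fun q => ?_) (funext fun q => ?_)
    (funext fun f => (h.2.2.2 f).trans (h'.2.2.2 f).symm)
  · refine mulVec_ext_of_span_eq_top hspan ?_
    rintro _ ⟨⟨w, j⟩, rfl⟩
    exact (h.A_mulVec q w j).trans (h'.A_mulVec q w j).symm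
  · ext i j
    exact congrFun ((h.1 q j).trans (h'.1 q j).symm) i
  · refine mulVec_ext_of_span_eq_top hspan ?_
    rintro _ ⟨⟨w, j⟩, rfl⟩
    exact (h.2.1 q w.lift j).trans (h'.2.1 q w.lift j).symm

theorem exists_isAlgorithmOutput [FiniteDimensional ℝ (colSpace Φ f₀ (N + 1) N)]
    (hrow : hankelRank Φ f₀ N N = hankelRank Φ f₀ (N + 1) N)
    (hcol : colSpace Φ f₀ N N = colSpace Φ f₀ N (N + 1))
    (φ : colSpace Φ f₀ N (N + 1) ≃ₗ[ℝ] (Fin n → ℝ)) :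
    ∃ R : Realization Φ n, R.IsAlgorithmOutput f₀ N φ := by
  choose T hT using exists_columnShift hrow
  let readout (q : Q) : colSpace Φ f₀ N (N + 1) →ₗ[ℝ] (Fin p → ℝ) :=
    LinearMap.funLeft ℝ ℝ (fun r => (emptyWord N, (q, r))) ∘ₗ Submodule.subtype _
  refine ⟨{ A := fun q => (φ.conj (T q ∘ₗ (LinearEquiv.ofEq _ _ hcol.symm).toLinearMap)).toMatrix'
            B := fun q => Matrix.of fun i j =>
              φ (colVec Φ f₀ N (N + 1) (emptyWord (N + 1)) (Sum.inr (q, j))) i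
            C := fun q => (readout q ∘ₗ φ.symm.toLinearMap).toMatrix'
            μ := fun f => φ (colVec Φ f₀ N (N + 1) (emptyWord (N + 1)) (Sum.inl f)) },
    fun q j => rfl, fun q w j => ?_, fun q w j => ?_, fun f => rfl⟩
  · rw [LinearMap.toMatrix'_mulVec, LinearMap.comp_apply, LinearEquiv.coe_coe,
      φ.symm_apply_apply]
    rfl
  · rw [LinearMap.toMatrix'_mulVec, LinearEquiv.conj_apply_apply, φ.symm_apply_apply,
      φ.symm_apply_apply]
    exact hT q w j

theorem existsUnique_isAlgorithmOutput [FiniteDimensional ℝ (colSpace Φ f₀ (N + 1) N)]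
    (hrow : hankelRank Φ f₀ N N = hankelRank Φ f₀ (N + 1) N)
    (hcol : colSpace Φ f₀ N N = colSpace Φ f₀ N (N + 1))
    (φ : colSpace Φ f₀ N (N + 1) ≃ₗ[ℝ] (Fin n → ℝ)) :
    ∃! R : Realization Φ n, R.IsAlgorithmOutput f₀ N φ :=
  existsUnique_of_exists_of_unique (exists_isAlgorithmOutput hrow hcol φ)
    fun _ _ h h' => h.eq h' hcol

theorem IsAlgorithmOutput.isMinimalPartialRealization (h : R.IsAlgorithmOutput f₀ N φ)
    (hcol : colSpace Φ f₀ N N = colSpace Φ f₀ N (N + 1)) :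
    R.IsMinimalPartialRealization f₀ (2 * N + 1) := by
  refine ⟨h.isPartialRealization hcol, fun n' R' hR' => ?_⟩
  have hn : hankelRank Φ f₀ N (N + 1) = n := φ.finrank_eq.trans (Module.finrank_fin_fun ℝ)
  exact hn.ge.trans (hR'.hankelRank_le (by omega))

variable [FiniteDimensional ℝ (colSpace Φ f₀ (N + 1) N)]
  [FiniteDimensional ℝ (colSpace Φ f₀ N (N + 1))]

theorem exists_isMinimalPartialRealization
    (hrow : hankelRank Φ f₀ N N = hankelRank Φ f₀ (N + 1) N)
    (hcol : colSpace Φ f₀ N N = colSpace Φ f₀ N (N + 1)) :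
    ∃ R : Realization Φ (hankelRank Φ f₀ N N), R.IsMinimalPartialRealization f₀ (2 * N + 1) := by
  have hrank : hankelRank Φ f₀ N N = hankelRank Φ f₀ N (N + 1) := by rw [hankelRank, hcol]; rfl
  obtain ⟨R, hR⟩ := exists_isAlgorithmOutput hrow hcol
    (LinearEquiv.ofFinrankEq _ _ (hrank.symm.trans (Module.finrank_fin_fun ℝ).symm))
  exact ⟨R, hR.isMinimalPartialRealization hcol⟩

theorem IsMinimalPartialRealization.le_hankelRank
    (h : R.IsMinimalPartialRealization f₀ (2 * N + 1))
    (hrow : hankelRank Φ f₀ N N = hankelRank Φ f₀ (N + 1) N)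
    (hcol : colSpace Φ f₀ N N = colSpace Φ f₀ N (N + 1)) : n ≤ hankelRank Φ f₀ N N := by
  obtain ⟨R₀, hR₀⟩ := exists_isMinimalPartialRealization hrow hcol
  exact h.2 _ R₀ hR₀.1

end Algorithm

end Realization

end SwitchedSystem

open SwitchedSystem Realization in
theorem theorem2_general {Q : Type*} {m p : ℕ} (Φ : Set (IOMap Q m p)) (f₀ : Φ)
    (N : ℕ) [FiniteDimensional ℝ (colSpace Φ f₀ (N + 1) N)]
    [FiniteDimensional ℝ (colSpace Φ f₀ N (N + 1))]
    (hrow : hankelRank Φ f₀ N N = hankelRank Φ f₀ (N + 1) N)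
    (hcol : hankelRank Φ f₀ (N + 1) N = hankelRank Φ f₀ N (N + 1)) :
    ((∃ (n : ℕ) (R : Realization Φ n), R.IsMinimalPartialRealization f₀ (2 * N + 1)) ∧
      ∀ φ : colSpace Φ f₀ N (N + 1) ≃ₗ[ℝ] (Fin (hankelRank Φ f₀ N (N + 1)) → ℝ),
        (∃! R : Realization Φ (hankelRank Φ f₀ N (N + 1)), R.IsAlgorithmOutput f₀ N φ) ∧
        ∀ R : Realization Φ (hankelRank Φ f₀ N (N + 1)),
          R.IsAlgorithmOutput f₀ N φ → R.IsMinimalPartialRealization f₀ (2 * N + 1)) ∧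
    (∀ (n : ℕ) (R : Realization Φ n), R.IsMinimalPartialRealization f₀ (2 * N + 1) →
        R.IsSemiReachable ∧ R.IsObservable ∧ n = hankelRank Φ f₀ N N) ∧
    (∀ (n₁ n₂ : ℕ) (R₁ : Realization Φ n₁) (R₂ : Realization Φ n₂),
      R₁.IsMinimalPartialRealization f₀ (2 * N + 1) →
      R₂.IsMinimalPartialRealization f₀ (2 * N + 1) → R₁.Isomorphic R₂) := by
  have heq := colSpace_eq_succ (hrow.trans hcol)
  refine ⟨⟨⟨_, exists_isMinimalPartialRealization hrow heq⟩, fun φ =>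
    ⟨existsUnique_isAlgorithmOutput hrow heq φ, fun R hR => hR.isMinimalPartialRealization heq⟩⟩,
    fun n R hR => ?_, fun n₁ n₂ R₁ R₂ h₁ h₂ => ?_⟩
  · have hle := hR.le_hankelRank hrow heq
    have hK : N + N ≤ 2 * N + 1 := by omega
    exact ⟨hR.1.isSemiReachable hK hle,
      isObservable_of_obsMap_injective (hR.1.obsMap_injective hK hle),
      hle.antisymm (hR.1.hankelRank_le hK)⟩
  · exact isomorphic_of_le_hankelRank h₁.1 h₂.1 (by omega)
      (h₁.le_hankelRank hrow heq) (h₂.le_hankelRank hrow heq)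

theorem theorem2 {Q : Type*} [Finite Q] {m p : ℕ}
    (Φ : Set (SwitchedSystem.IOMap Q m p)) (f₀ : Φ)
    (hΦ : SwitchedSystem.HasGeneralizedKernelRepresentation Φ)
    (N : ℕ) (hN : 0 < N)
    (hrow : SwitchedSystem.hankelRank Φ f₀ N N = SwitchedSystem.hankelRank Φ f₀ (N + 1) N)
    (hcol : SwitchedSystem.hankelRank Φ f₀ (N + 1) N =
      SwitchedSystem.hankelRank Φ f₀ N (N + 1)) :
    ((∃ (n : ℕ) (R : SwitchedSystem.Realization Φ n),
        R.IsMinimalPartialRealization f₀ (2 * N + 1)) ∧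
      ∀ φ : SwitchedSystem.colSpace Φ f₀ N (N + 1) ≃ₗ[ℝ]
          (Fin (SwitchedSystem.hankelRank Φ f₀ N (N + 1)) → ℝ),
        (∃! R : SwitchedSystem.Realization Φ (SwitchedSystem.hankelRank Φ f₀ N (N + 1)),
          R.IsAlgorithmOutput f₀ N φ) ∧
        ∀ R : SwitchedSystem.Realization Φ (SwitchedSystem.hankelRank Φ f₀ N (N + 1)),
          R.IsAlgorithmOutput f₀ N φ → R.IsMinimalPartialRealization f₀ (2 * N + 1)) ∧
    (∀ (n : ℕ) (R : SwitchedSystem.Realization Φ n),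
      R.IsMinimalPartialRealization f₀ (2 * N + 1) →
        R.IsSemiReachable ∧ R.IsObservable ∧ n = SwitchedSystem.hankelRank Φ f₀ N N) ∧
    (∀ (n₁ n₂ : ℕ) (R₁ : SwitchedSystem.Realization Φ n₁) (R₂ : SwitchedSystem.Realization Φ n₂),
      R₁.IsMinimalPartialRealization f₀ (2 * N + 1) →
      R₂.IsMinimalPartialRealization f₀ (2 * N + 1) →
        R₁.Isomorphic R₂) := by
  exact theorem2_general Φ f₀ N hrow hcol
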